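/- Matrices are real of size $m\times n$, and $\|\cdot\|$ is the Frobenius norm. One step of the (first-order) rank-$r$ projector-splitting integrator with increment $\Delta A=A(t_1)-A(t_0)$, $t_1=t_0+h$, takes factors $U_0,S_0,V_0$ of $Y_0=U_0S_0V_0^\top$ (where $U_0\in\mathbb R^{m\times r}$ and $V_0\in\mathbb R^{n\times r}$ have orthonormal columns and $S_0\in\mathbb R^{r\times r}$) to factors $U_1,S_1,V_1$ of $Y_1=U_1S_1V_1^\top$ as follows: (1) factorize $U_0S_0+\Delta A\,V_0=U_1\widehat S_1$, where $U_1\in\mathbb R^{m\times r}$ has orthonormal columns and $\widehat S_1\in\mathbb R^{r\times r}$; (2) set $\widetilde S_0=\widehat S_1-U_1^\top\Delta A\,V_0$; (3) factorize $V_0\widetilde S_0^\top+\Delta A^\top U_1=V_1S_1^\top$, where $V_1\in\mathbb R^{n\times r}$ has orthonormal columns and $S_1\in\mathbb R^{r\times r}$. Any choice of the factorizations in (1) and (3) is allowed. Further steps are taken in the same way, continuing with the factors obtained. Let $q<r$, $t_0\le T$ and $\varepsilon>0$, and let $A(t)=A'(t)+\varepsilon A''(t)$ for $t_0\le t\le T$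 (primes are not derivatives), where $\operatorname{rank}A'(t)=q$ for all $t$ and where $A'$, $A''$ are differentiable on $[t_0,T]$ and they and their derivatives are bounded by a constant $B$ independent of $\varepsilon$. Let $$Y_0=A'(t_0)+\varepsilon A_0'',\quad \operatorname{rank}Y_0=r,\qquad \bar Y_0=A'(t_0)+\varepsilon\bar A_0'',\quad \operatorname{rank}\bar Y_0=q,$$ with $\|A_0''\|,\|\bar A_0''\|\le B$. Let $Y_N$ and $\bar Y_N$ be results of $N$ steps, with step size $h>0$, of the splitting integrator for $A$ of rank $r$ started from $Y_0$ and of rank $q$ started from $\bar Y_0$, respectively. Then, as long as $t_0+Nh\le T$, $$\|Y_N-\bar Y_N\|\le C(\varepsilon+h),$$ where $C$ is independent of $N$, $h$ and $\varepsilon$ (but depends on $T-t_0$). More precisely: (i) If, for all $t\in[t_0,T]$, $A'(t)=U'(t)S'(t)V'(t)^\top$, where $U'(t)$ and $V'(t)$ have $q$ orthonormal columns and $S'(t)$ is an invertible $q\times q$ matrix with $\|S'(t)^{-1}\|\le B$, then $C$ can be chosen to depend only on $m,n,q,r$, on $B$ and on an upper bound for $T-t_0$; here $A'$, $A''$, $A_0''$,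 $\bar A_0''$ may all vary with $\varepsilon$. (ii) If $A'$ is fixed (independent of $\varepsilon$), no bound on an inverse is assumed, and $C$ can be chosen to depend only on $m,n,q,r,t_0,T,B$ and the function $A'$; here $A''$, $A_0''$, $\bar A_0''$ may vary with $\varepsilon$. -/

import Mathlib

open Set Matrix

-- The norm of a real matrix is the Frobenius norm.
attribute [local instance] Matrix.frobeniusNormedAddCommGroup Matrix.frobeniusNormedSpace

/-- Factors `U`, `S`, `V` of a matrix `U * S * Vᵀ` of size `m × n` and rank at most `r`. -/
structure LowRankFactors (m n r : ℕ) where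
  U : Matrix (Fin m) (Fin r) ℝ
  S : Matrix (Fin r) (Fin r) ℝ
  V : Matrix (Fin n) (Fin r) ℝ

/-- The matrix `U * S * Vᵀ` represented by the factors. -/
def LowRankFactors.toMatrix {m n r : ℕ} (F : LowRankFactors m n r) :
    Matrix (Fin m) (Fin n) ℝ :=
  F.U * F.S * F.Vᵀ

/-- `U` has orthonormal columns. -/
def OrthonormalColumns {m r : ℕ} (U : Matrix (Fin m) (Fin r) ℝ) : Prop :=
  Uᵀ * U = 1

/-- `F` is a factorization `Y = U * S * Vᵀ` with orthonormal columns in `U` and in `V`. -/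
structure LowRankFactors.Represents {m n r : ℕ} (F : LowRankFactors m n r)
    (Y : Matrix (Fin m) (Fin n) ℝ) : Prop where
  orthU : OrthonormalColumns F.U
  orthV : OrthonormalColumns F.V
  eq : Y = F.toMatrix

/-- One step (K-step, S-step, L-step) of the first-order projector-splitting integrator for
rank-`r` approximation with increment `ΔA`, taking the factors `F₀` to the factors `F₁`. The two
factorizations into a matrix with orthonormal columns and an `r × r` matrix (by QR, SVD, ...) are
not unique; every choice is a step. -/
def SplittingStep {m n r : ℕ} (ΔA : Matrix (Fin m) (Fin n) ℝ)
    (F₀ F₁ : LowRankFactors m n r) : Prop :=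
  ∃ (K₁ : Matrix (Fin m) (Fin r) ℝ) (Shat₁ Stilde₀ : Matrix (Fin r) (Fin r) ℝ)
    (L₁ : Matrix (Fin n) (Fin r) ℝ),
    K₁ = F₀.U * F₀.S + ΔA * F₀.V ∧
    OrthonormalColumns F₁.U ∧ F₁.U * Shat₁ = K₁ ∧
    Stilde₀ = Shat₁ - F₁.Uᵀ * ΔA * F₀.V ∧
    L₁ = F₀.V * Stilde₀ᵀ + ΔAᵀ * F₁.U ∧
    OrthonormalColumns F₁.V ∧ F₁.V * F₁.Sᵀ = L₁

/-- `Y` is a result of `N` steps of the rank-`r` splitting integrator applied to `A` with step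
size `h`, from the starting value `Y₀` at time `t₀`. The factors are carried from step to step. -/
def SplittingResult {m n : ℕ} (r : ℕ) (A : ℝ → Matrix (Fin m) (Fin n) ℝ) (t₀ h : ℝ) (N : ℕ)
    (Y₀ Y : Matrix (Fin m) (Fin n) ℝ) : Prop :=
  ∃ F : ℕ → LowRankFactors m n r,
    (F 0).Represents Y₀ ∧
    (∀ k < N, SplittingStep (A (t₀ + ((k : ℝ) + 1) * h) - A (t₀ + (k : ℝ) * h)) (F k) (F (k + 1))) ∧
    Y = (F N).toMatrix

/-- `A` is differentiable on `[t₀, T]`, and `A` and its derivative are bounded by `B` there. -/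
structure BoundedWithDerivative {m n : ℕ} (A : ℝ → Matrix (Fin m) (Fin n) ℝ)
    (t₀ T B : ℝ) : Prop where
  diff : DifferentiableOn ℝ A (Icc t₀ T)
  bound : ∀ t ∈ Icc t₀ T, ‖A t‖ ≤ B
  bound_deriv : ∀ t ∈ Icc t₀ T, ‖derivWithin A (Icc t₀ T) t‖ ≤ B

/-- The situation of over-approximation: `A' + ε A''` is a perturbation of a matrix function `A'`
of rank `q`, and `Y₀`, `Ybar₀` are starting values of rank `r` and of rank `q` that are
`ε`-perturbations of `A' t₀`. All bounds are by `B`. -/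
structure OverApproximation {m n : ℕ} (q r : ℕ) (t₀ T B ε : ℝ)
    (A' A'' : ℝ → Matrix (Fin m) (Fin n) ℝ) (Y₀ Ybar₀ : Matrix (Fin m) (Fin n) ℝ) : Prop where
  reg' : BoundedWithDerivative A' t₀ T B
  reg'' : BoundedWithDerivative A'' t₀ T B
  rank_A' : ∀ t ∈ Icc t₀ T, (A' t).rank = q
  start : ∃ A₀'' : Matrix (Fin m) (Fin n) ℝ, ‖A₀''‖ ≤ B ∧ Y₀ = A' t₀ + ε • A₀''
  rank_start : Y₀.rank = r
  startBar : ∃ Abar₀'' : Matrix (Fin m) (Fin n) ℝ, ‖Abar₀''‖ ≤ B ∧ Ybar₀ = A' t₀ + ε • Abar₀''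
  rank_startBar : Ybar₀.rank = q

/-! Both integrators are compared with `A'`, for which it is enough to bound one step. With P = 1 -
U₁U₁ᵀ and Q = 1 - V₀V₀ᵀ, a step adds ΔA up to the error PΔAQ (`SplittingStep.toMatrix_eq`). This
must be O(h(ε + h)) plus O(h) times the current error; ‖ΔA‖ = O(h) alone would accumulate to O(1).
The ε-part of ΔA contributes O(εh). For the rest, let A₀, A₁ be successive values of `A'`, with
bounded generalized inverses G₀, G₁. Then A₁ - A₀ = A₀X + WA₀ + O(h²) with X, W = O(h)
(`sub_eq_of_generalized_inverse`): a tangential part and a curvature term. Since Q annihilates Y₀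
and P annihilates Y₀ + ΔA V₀V₀ᵀ, both PA₀ and A₀Q are of the size of the current error plus O(h). No
singular value of Y₀ enters. A discrete Gronwall argument sums the local errors. Bounded generalized
inverses come from the bound on S'⁻¹ in the first part, and from constant rank and compactness in
the second. -/

/-- The columns of a matrix with `r` orthonormal columns have total squared length `r`. -/
theorem OrthonormalColumns.norm_sq {m r : ℕ} {U : Matrix (Fin m) (Fin r) ℝ}
    (hU : OrthonormalColumns U) : ‖U‖ ^ 2 = r := by
  have hcol : ∀ j, ∑ i, U i j ^ 2 = 1 := fun j => by
    have := congrFun (congrFun hU j) j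
    simpa [Matrix.mul_apply, sq] using this
  rw [Matrix.frobenius_norm_def, ← Real.sqrt_eq_rpow, Real.sq_sqrt (by positivity),
    Finset.sum_comm]
  simp [hcol]

theorem OrthonormalColumns.norm_mul_transpose_le {m r : ℕ} {U : Matrix (Fin m) (Fin r) ℝ}
    (hU : OrthonormalColumns U) : ‖U * Uᵀ‖ ≤ r := by
  calc ‖U * Uᵀ‖ ≤ ‖U‖ * ‖Uᵀ‖ := Matrix.frobenius_norm_mul _ _
    _ = r := by rw [Matrix.frobenius_norm_transpose, ← sq, hU.norm_sq]

/-- Submultiplicativity of the Frobenius norm, with bounds of the factors. -/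
theorem frobenius_norm_mul_le_of_le {l m n : ℕ} {X : Matrix (Fin l) (Fin m) ℝ}
    {Y : Matrix (Fin m) (Fin n) ℝ} {a b : ℝ} (hX : ‖X‖ ≤ a) (hY : ‖Y‖ ≤ b) :
    ‖X * Y‖ ≤ a * b :=
  (Matrix.frobenius_norm_mul X Y).trans
    (mul_le_mul hX hY (norm_nonneg _) ((norm_nonneg _).trans hX))

/-! ### Algebra of one splitting step -/

/-- The error of a splitting step, compared with adding the increment, is the part of the
increment which is annihilated by the projections onto the new column space and onto the old
row space. -/
theorem SplittingStep.toMatrix_eq {m n r : ℕ} {D : Matrix (Fin m) (Fin n) ℝ}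
    {F₀ F₁ : LowRankFactors m n r} (hs : SplittingStep D F₀ F₁) :
    F₁.toMatrix = F₀.toMatrix + D - (1 - F₁.U * F₁.Uᵀ) * D * (1 - F₀.V * F₀.Vᵀ) := by
  obtain ⟨K, Sh, St, L, rfl, -, hK, rfl, rfl, -, hL⟩ := hs
  have hL' := congrArg Matrix.transpose hL
  simp only [transpose_mul, transpose_transpose, transpose_add, transpose_sub] at hL'
  unfold LowRankFactors.toMatrix
  rw [Matrix.mul_assoc, hL']
  -- The K-step adds D V₀V₀ᵀ, the S-step subtracts U₁U₁ᵀ D V₀V₀ᵀ and the L-step adds U₁U₁ᵀ D. Only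
  -- the doubly complementary part of D is missing from the sum.
  have hK' : F₁.U * (Sh * F₀.Vᵀ) = F₀.U * F₀.S * F₀.Vᵀ + D * F₀.V * F₀.Vᵀ := by
    rw [← Matrix.mul_assoc, hK, Matrix.add_mul]
  simp only [Matrix.mul_add, Matrix.sub_mul, Matrix.mul_sub, Matrix.one_mul, Matrix.mul_one, hK']
  simp only [Matrix.mul_assoc]
  abel

/-- The new column space contains the range of the matrix after the K-step. -/
theorem SplittingStep.complement_mul {m n r : ℕ} {D : Matrix (Fin m) (Fin n) ℝ}
    {F₀ F₁ : LowRankFactors m n r} (hs : SplittingStep D F₀ F₁) :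
    (1 - F₁.U * F₁.Uᵀ) * F₀.toMatrix = -((1 - F₁.U * F₁.Uᵀ) * (D * (F₀.V * F₀.Vᵀ))) := by
  obtain ⟨K, Sh, St, L, rfl, hU, hK, -⟩ := hs
  have h0 : (1 - F₁.U * F₁.Uᵀ) * F₁.U = 0 := by
    rw [Matrix.sub_mul, Matrix.mul_assoc, hU, Matrix.one_mul, Matrix.mul_one, sub_self]
  rw [eq_neg_iff_add_eq_zero, ← Matrix.mul_add]
  have : F₀.toMatrix + D * (F₀.V * F₀.Vᵀ) = F₁.U * (Sh * F₀.Vᵀ) := by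
    rw [← Matrix.mul_assoc F₁.U, hK, Matrix.add_mul, LowRankFactors.toMatrix, Matrix.mul_assoc D]
  rw [this, ← Matrix.mul_assoc, h0, Matrix.zero_mul]

theorem SplittingStep.orthonormalColumns_V {m n r : ℕ} {D : Matrix (Fin m) (Fin n) ℝ}
    {F₀ F₁ : LowRankFactors m n r} (hs : SplittingStep D F₀ F₁) : OrthonormalColumns F₁.V := by
  obtain ⟨K, Sh, St, L, -, -, -, -, -, hV, -⟩ := hs
  exact hV

theorem SplittingStep.orthonormalColumns_U {m n r : ℕ} {D : Matrix (Fin m) (Fin n) ℝ}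
    {F₀ F₁ : LowRankFactors m n r} (hs : SplittingStep D F₀ F₁) : OrthonormalColumns F₁.U := by
  obtain ⟨K, Sh, St, L, -, hU, -⟩ := hs
  exact hU

theorem LowRankFactors.toMatrix_mul_complement {m n r : ℕ} {F : LowRankFactors m n r}
    (hV : OrthonormalColumns F.V) : F.toMatrix * (1 - F.V * F.Vᵀ) = 0 := by
  have hV' : F.Vᵀ * F.V = 1 := hV
  rw [toMatrix, Matrix.mul_sub, Matrix.mul_one, Matrix.mul_assoc (F.U * F.S),
    ← Matrix.mul_assoc F.Vᵀ,
    hV', Matrix.one_mul, sub_self]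

/-! ### Generalized inverses and the local error -/

/-- Decomposition of the difference of two matrices having generalized inverses. -/
theorem sub_eq_of_generalized_inverse {m n : ℕ} {A₀ A₁ : Matrix (Fin m) (Fin n) ℝ}
    {G₀ G₁ : Matrix (Fin n) (Fin m) ℝ} (h₀ : A₀ * G₀ * A₀ = A₀) (h₁ : A₁ * G₁ * A₁ = A₁) :
    A₁ - A₀ = A₀ * (G₀ * (A₁ - A₀)) + (1 - A₀ * G₀) * ((A₁ - A₀) * G₀) * A₀ +
      (1 - A₀ * G₀) * ((A₁ - A₀) * (G₁ * (A₁ - A₀))) * (1 - G₀ * A₀) := by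
  have hl : (1 - A₀ * G₀) * A₀ = 0 := by rw [Matrix.sub_mul, h₀, Matrix.one_mul, sub_self]
  have hr : A₀ * (1 - G₀ * A₀) = 0 := by
    rw [Matrix.mul_sub, ← Matrix.mul_assoc, h₀, Matrix.mul_one, sub_self]
  -- The outer factors annihilate A₀, so A₁ - A₀ may be replaced by A₁ next to them; then A₁G₁A₁ =
  -- A₁ makes the quadratic expression equal to the linear one.
  have key : (1 - A₀ * G₀) * ((A₁ - A₀) * (G₁ * (A₁ - A₀))) * (1 - G₀ * A₀) =
      (1 - A₀ * G₀) * (A₁ - A₀) * (1 - G₀ * A₀) := by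
    have e1 : (1 - A₀ * G₀) * (A₁ - A₀) = (1 - A₀ * G₀) * A₁ := by
      rw [Matrix.mul_sub, hl, sub_zero]
    have e2 : (A₁ - A₀) * (1 - G₀ * A₀) = A₁ * (1 - G₀ * A₀) := by
      rw [Matrix.sub_mul, hr, sub_zero]
    calc _ = ((1 - A₀ * G₀) * (A₁ - A₀)) * (G₁ * ((A₁ - A₀) * (1 - G₀ * A₀))) := by
          simp only [Matrix.mul_assoc]
      _ = (1 - A₀ * G₀) * (A₁ * G₁ * A₁) * (1 - G₀ * A₀) := by
          rw [e1, e2]; simp only [Matrix.mul_assoc]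
      _ = _ := by rw [h₁, e1]
  rw [key]
  simp only [Matrix.sub_mul, Matrix.mul_sub, Matrix.one_mul, Matrix.mul_one, Matrix.mul_assoc]
  abel

/-- Bound of a doubly projected difference of two matrices having bounded generalized inverses:
it is of second order if the projections nearly annihilate one of the two matrices. -/
theorem norm_mul_sub_mul_le {m n : ℕ} {A₀ A₁ : Matrix (Fin m) (Fin n) ℝ}
    {G₀ G₁ : Matrix (Fin n) (Fin m) ℝ} (h₀ : A₀ * G₀ * A₀ = A₀) (h₁ : A₁ * G₁ * A₁ = A₁)
    {P : Matrix (Fin m) (Fin m) ℝ} {Q : Matrix (Fin n) (Fin n) ℝ} {M J K a b d : ℝ}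
    (hG₀ : ‖G₀‖ ≤ M) (hG₁ : ‖G₁‖ ≤ M) (hJ : ‖1 - A₀ * G₀‖ ≤ J) (hJ' : ‖1 - G₀ * A₀‖ ≤ J)
    (hP : ‖P‖ ≤ K) (hQ : ‖Q‖ ≤ K) (ha : ‖P * A₀‖ ≤ a) (hb : ‖A₀ * Q‖ ≤ b)
    (hd : ‖A₁ - A₀‖ ≤ d) :
    ‖P * (A₁ - A₀) * Q‖ ≤ a * (M * d) * K + K * (J * (d * M) * b) +
      K * (J * (d * (M * d)) * J) * K := by
  have e : P * (A₁ - A₀) * Q = P * A₀ * (G₀ * (A₁ - A₀)) * Q +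
      P * ((1 - A₀ * G₀) * ((A₁ - A₀) * G₀) * (A₀ * Q)) +
      P * ((1 - A₀ * G₀) * ((A₁ - A₀) * (G₁ * (A₁ - A₀))) * (1 - G₀ * A₀)) * Q := by
    conv_lhs => rw [sub_eq_of_generalized_inverse h₀ h₁]
    simp only [Matrix.mul_add, Matrix.add_mul, Matrix.mul_assoc]
  rw [e]
  have hD₀ := frobenius_norm_mul_le_of_le hd hG₀
  have hD₁ := frobenius_norm_mul_le_of_le hd (frobenius_norm_mul_le_of_le hG₁ hd)
  have b₁ := frobenius_norm_mul_le_of_le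
    (frobenius_norm_mul_le_of_le ha (frobenius_norm_mul_le_of_le hG₀ hd)) hQ
  have b₂ := frobenius_norm_mul_le_of_le hP
    (frobenius_norm_mul_le_of_le (frobenius_norm_mul_le_of_le hJ hD₀) hb)
  have b₃ := frobenius_norm_mul_le_of_le (frobenius_norm_mul_le_of_le hP
    (frobenius_norm_mul_le_of_le (frobenius_norm_mul_le_of_le hJ hD₁) hJ')) hQ
  exact norm_add_le_of_le (norm_add_le_of_le b₁ b₂) b₃

/-- Local error bound of the splitting integrator near a path of matrices with bounded
generalized inverses, independent of the singular values of the approximation. -/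
theorem SplittingStep.norm_toMatrix_sub_le {m n r : ℕ} {L B M : ℝ} (hL : 0 ≤ L) (hB : 0 ≤ B)
    (hM : 0 ≤ M) : ∃ C : ℝ, 0 ≤ C ∧ ∀ (h ε : ℝ) (A₀ A₁ D : Matrix (Fin m) (Fin n) ℝ)
      (G₀ G₁ : Matrix (Fin n) (Fin m) ℝ) (F₀ F₁ : LowRankFactors m n r),
      0 ≤ h → h ≤ L → 0 ≤ ε → A₀ * G₀ * A₀ = A₀ → A₁ * G₁ * A₁ = A₁ → ‖A₀‖ ≤ B →
      ‖G₀‖ ≤ M → ‖G₁‖ ≤ M → ‖A₁ - A₀‖ ≤ B * h → ‖D‖ ≤ B * h → OrthonormalColumns F₀.V →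
      SplittingStep (A₁ - A₀ + ε • D) F₀ F₁ →
      ‖F₁.toMatrix - A₁‖ ≤
        ‖F₀.toMatrix - A₀‖ + C * h * (‖F₀.toMatrix - A₀‖ + (ε + h)) := by
  set K : ℝ := ‖(1 : Matrix (Fin m) (Fin m) ℝ)‖ + ‖(1 : Matrix (Fin n) (Fin n) ℝ)‖ + r with hK
  have hm := norm_nonneg (1 : Matrix (Fin m) (Fin m) ℝ)
  have hn := norm_nonneg (1 : Matrix (Fin n) (Fin n) ℝ)
  have hr : (0 : ℝ) ≤ r := Nat.cast_nonneg r
  have hK0 : 0 ≤ K := by positivity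
  set J : ℝ := K + B * M with hJ
  have hJ0 : 0 ≤ J := by positivity
  -- The coefficients of h(δ + ε + h), δ being the error before the step: two terms from ε • D, then
  -- the three terms of `norm_mul_sub_mul_le`.
  refine ⟨B + K * B * K + K * (1 + (1 + L) * B * K) * M * B * K + K * J * B * M * K +
    K * J * B * M * B * J * K, by positivity, ?_⟩
  intro h ε A₀ A₁ D G₀ G₁ F₀ F₁ hh hhL hε h₀ h₁ hA₀ hG₀ hG₁ hd hD hV hs
  set δ := ‖F₀.toMatrix - A₀‖ with hδ
  have hδ0 : 0 ≤ δ := norm_nonneg _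
  have hU := hs.orthonormalColumns_U
  set P := 1 - F₁.U * F₁.Uᵀ with hPdef
  set Q := 1 - F₀.V * F₀.Vᵀ with hQdef
  have hP : ‖P‖ ≤ K := (norm_sub_le _ _).trans (by linarith [hU.norm_mul_transpose_le])
  have hQ : ‖Q‖ ≤ K := (norm_sub_le _ _).trans (by linarith [hV.norm_mul_transpose_le])
  have hVV : ‖F₀.V * F₀.Vᵀ‖ ≤ K := by linarith [hV.norm_mul_transpose_le]
  have hεD : ‖ε • D‖ ≤ ε * (B * h) := by
    rw [norm_smul, Real.norm_of_nonneg hε]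
    exact mul_le_mul_of_nonneg_left hD hε
  have hΔ : ‖A₁ - A₀ + ε • D‖ ≤ B * h + ε * (B * h) := norm_add_le_of_le hd hεD
  have hJ₀ : ‖1 - A₀ * G₀‖ ≤ J := (norm_sub_le _ _).trans
    (by linarith [frobenius_norm_mul_le_of_le hA₀ hG₀])
  have hJ₁ : ‖1 - G₀ * A₀‖ ≤ J := (norm_sub_le _ _).trans
    (by linarith [frobenius_norm_mul_le_of_le hG₀ hA₀])
  have hb : ‖A₀ * Q‖ ≤ δ * K := by
    have : A₀ * Q = -((F₀.toMatrix - A₀) * Q) := by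
      rw [Matrix.sub_mul, LowRankFactors.toMatrix_mul_complement hV, zero_sub, neg_neg]
    rw [this, norm_neg]
    exact frobenius_norm_mul_le_of_le le_rfl hQ
  have ha : ‖P * A₀‖ ≤ K * (δ + (B * h + ε * (B * h)) * K) := by
    have : P * A₀ = -(P * ((F₀.toMatrix - A₀) + (A₁ - A₀ + ε • D) * (F₀.V * F₀.Vᵀ))) := by
      rw [Matrix.mul_add, Matrix.mul_sub, hs.complement_mul]
      abel
    rw [this, norm_neg]
    exact frobenius_norm_mul_le_of_le hP
      (norm_add_le_of_le le_rfl (frobenius_norm_mul_le_of_le hΔ hVV))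
  -- The bound h ≤ L absorbs the product εh into a multiple of ε.
  have ha' : K * (δ + (B * h + ε * (B * h)) * K) ≤
      K * (1 + (1 + L) * B * K) * (δ + (ε + h)) := by
    have h1 : ε * h ≤ ε * L := mul_le_mul_of_nonneg_left hhL hε
    have h2 : h + ε * h ≤ (1 + L) * (δ + (ε + h)) := by nlinarith [mul_nonneg hL hδ0, mul_nonneg hL hh]
    calc K * (δ + (B * h + ε * (B * h)) * K) = K * (δ + (h + ε * h) * (B * K)) := by ring
      _ ≤ K * ((δ + (ε + h)) + ((1 + L) * (δ + (ε + h))) * (B * K)) := by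
        gcongr; linarith
      _ = _ := by ring
  have hmain := norm_mul_sub_mul_le h₀ h₁ hG₀ hG₁ hJ₀ hJ₁ hP hQ (ha.trans ha') hb hd
  have hrest : ‖P * (ε • D) * Q‖ ≤ K * (ε * (B * h)) * K :=
    frobenius_norm_mul_le_of_le (frobenius_norm_mul_le_of_le hP hεD) hQ
  have e : F₁.toMatrix - A₁ = (F₀.toMatrix - A₀) + ε • D - P * (A₁ - A₀) * Q -
      P * (ε • D) * Q := by
    rw [hs.toMatrix_eq, Matrix.mul_add, Matrix.add_mul]
    abel
  rw [e]
  refine (norm_sub_le_of_le (norm_sub_le_of_le (norm_add_le_of_le le_rfl hεD) hmain)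
    hrest).trans ?_
  set x := δ + (ε + h) with hx
  have hεx : ε ≤ x := by linarith
  have hδx : δ ≤ x := by linarith
  have hhx : h ≤ x := by linarith
  calc _ = δ + (ε * (B * h) + K * (1 + (1 + L) * B * K) * x * (M * (B * h)) * K +
        K * (J * (B * h * M) * (δ * K)) + K * (J * (B * h * (M * (B * h))) * J) * K +
        K * (ε * (B * h)) * K) := by ring
    _ ≤ δ + (x * (B * h) + K * (1 + (1 + L) * B * K) * x * (M * (B * h)) * K +
        K * (J * (B * h * M) * (x * K)) + K * (J * (B * h * (M * (B * x))) * J) * K +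
        K * (x * (B * h)) * K) := by gcongr
    _ = _ := by ring

/-! ### Accumulation of the local errors -/

/-- A function that is bounded together with its derivative is Lipschitz continuous. -/
theorem BoundedWithDerivative.norm_apply_sub_le {m n : ℕ} {A : ℝ → Matrix (Fin m) (Fin n) ℝ}
    {t₀ T B : ℝ} (hA : BoundedWithDerivative A t₀ T B) {s t : ℝ} (hs : s ∈ Icc t₀ T)
    (ht : t ∈ Icc t₀ T) : ‖A t - A s‖ ≤ B * |t - s| :=
  (convex_Icc t₀ T).norm_image_sub_le_of_norm_derivWithin_le hA.diff hA.bound_deriv hs ht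

/-- Global error bound of the splitting integrator near a path of matrices with bounded
generalized inverses. -/
theorem SplittingResult.norm_sub_apply_le {m n : ℕ} (r : ℕ) {L B M : ℝ} (hL : 0 ≤ L) (hB : 0 ≤ B)
    (hM : 0 ≤ M) : ∃ C : ℝ, ∀ (t₀ T ε : ℝ) (A' A'' : ℝ → Matrix (Fin m) (Fin n) ℝ)
      (E Y : Matrix (Fin m) (Fin n) ℝ) (h : ℝ) (N : ℕ),
      T - t₀ ≤ L → 0 < ε → BoundedWithDerivative A' t₀ T B → BoundedWithDerivative A'' t₀ T B →
      (∀ t ∈ Icc t₀ T, ∃ G : Matrix (Fin n) (Fin m) ℝ, A' t * G * A' t = A' t ∧ ‖G‖ ≤ M) →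
      ‖E‖ ≤ B → 0 < h → t₀ + N * h ≤ T →
      SplittingResult r (fun t => A' t + ε • A'' t) t₀ h N (A' t₀ + ε • E) Y →
      ‖Y - A' (t₀ + N * h)‖ ≤ C * (ε + h) := by
  obtain ⟨C, hC, hstep⟩ := SplittingStep.norm_toMatrix_sub_le (m := m) (n := n) (r := r) hL hB hM
  refine ⟨Real.exp (C * L) * (B + 1), ?_⟩
  rintro t₀ T ε A' A'' E Y h N hTL hε hA' hA'' hG hE hh hN ⟨F, hF0, hF, rfl⟩
  have hmem : ∀ k : ℕ, k ≤ N → t₀ + k * h ∈ Icc t₀ T := fun k hk => by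
    have : (k : ℝ) ≤ N := Nat.cast_le.2 hk
    constructor
    · nlinarith [(Nat.cast_nonneg k : (0 : ℝ) ≤ k)]
    · nlinarith
  have hV : ∀ k ≤ N, OrthonormalColumns (F k).V := by
    rintro (_ | k) hk
    · exact hF0.orthV
    · exact (hF k hk).orthonormalColumns_V
  -- Adding ε + h to the error makes the recursion purely multiplicative, with factor 1 + Ch per
  -- step.
  have hrec : ∀ k ≤ N, ‖(F k).toMatrix - A' (t₀ + k * h)‖ + (ε + h) ≤
      (1 + C * h) ^ k * (ε * B + (ε + h)) := by
    intro k
    induction k with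
    | zero =>
      intro _
      have : ‖ε • E‖ ≤ ε * B := by
        rw [norm_smul, Real.norm_of_nonneg hε.le]
        exact mul_le_mul_of_nonneg_left hE hε.le
      simpa [← hF0.eq] using this
    | succ k ih =>
      intro hk
      have m₀ := hmem k (by omega)
      have m₁ := hmem (k + 1) hk
      push_cast at m₁ ⊢
      obtain ⟨G₀, hG₀, hG₀M⟩ := hG _ m₀
      obtain ⟨G₁, hG₁, hG₁M⟩ := hG _ m₁
      have habs : |t₀ + ((k : ℝ) + 1) * h - (t₀ + k * h)| = h := by
        rw [show t₀ + ((k : ℝ) + 1) * h - (t₀ + k * h) = h by ring, abs_of_pos hh]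
      have d' := hA'.norm_apply_sub_le m₀ m₁
      have d'' := hA''.norm_apply_sub_le m₀ m₁
      rw [habs] at d' d''
      have hs := hF k hk
      have hinc : ∀ a b c d : Matrix (Fin m) (Fin n) ℝ,
          a + ε • b - (c + ε • d) = a - c + ε • (b - d) := fun a b c d => by
        rw [smul_sub]; abel
      simp only [hinc] at hs
      -- A whole step fits into [t₀, T].
      have hhL : h ≤ L := by nlinarith [m₀.1, m₁.2]
      have := hstep h ε _ _ _ G₀ G₁ (F k) (F (k + 1)) hh.le hhL hε.le hG₀ hG₁
        (hA'.bound _ m₀) hG₀M hG₁M d' d'' (hV k (by omega)) hs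
      calc _ ≤ (1 + C * h) * (‖(F k).toMatrix - A' (t₀ + k * h)‖ + (ε + h)) := by linarith
        _ ≤ (1 + C * h) * ((1 + C * h) ^ k * (ε * B + (ε + h))) :=
          mul_le_mul_of_nonneg_left (ih (by omega)) (by positivity)
        _ = _ := by ring
  have hpow : (1 + C * h) ^ N ≤ Real.exp (C * L) := by
    calc (1 + C * h) ^ N ≤ Real.exp (C * h) ^ N := by
          gcongr
          linarith [Real.add_one_le_exp (C * h)]
      _ = Real.exp (C * (N * h)) := by rw [← Real.exp_nat_mul]; ring_nf
      _ ≤ Real.exp (C * L) := by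
          gcongr
          linarith
  calc ‖(F N).toMatrix - A' (t₀ + N * h)‖ ≤ (1 + C * h) ^ N * (ε * B + (ε + h)) := by
        linarith [hrec N le_rfl]
    _ ≤ Real.exp (C * L) * ((ε + h) * B + (ε + h)) := by
        gcongr
        linarith
    _ = _ := by ring

/-- Two splitting integrators, of arbitrary ranks, near a path of matrices with bounded
generalized inverses give nearby results. -/
theorem SplittingResult.norm_sub_le_of_overApproximation {m n q r : ℕ} {L B M : ℝ} :
    ∃ C : ℝ, ∀ (t₀ T ε : ℝ) (A' A'' : ℝ → Matrix (Fin m) (Fin n) ℝ)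
      (Y₀ Ybar₀ : Matrix (Fin m) (Fin n) ℝ), t₀ ≤ T → T - t₀ ≤ L → 0 < ε →
      OverApproximation q r t₀ T B ε A' A'' Y₀ Ybar₀ →
      (∀ t ∈ Icc t₀ T, ∃ G : Matrix (Fin n) (Fin m) ℝ, A' t * G * A' t = A' t ∧ ‖G‖ ≤ M) →
      ∀ (h : ℝ) (N : ℕ) (Y Ybar : Matrix (Fin m) (Fin n) ℝ),
        0 < h → t₀ + N * h ≤ T →
        SplittingResult r (fun t => A' t + ε • A'' t) t₀ h N Y₀ Y →
        SplittingResult q (fun t => A' t + ε • A'' t) t₀ h N Ybar₀ Ybar →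
        ‖Y - Ybar‖ ≤ C * (ε + h) := by
  by_cases hpos : 0 ≤ L ∧ 0 ≤ B ∧ 0 ≤ M
  · obtain ⟨hL, hB, hM⟩ := hpos
    obtain ⟨C₁, h₁⟩ := SplittingResult.norm_sub_apply_le (m := m) (n := n) r hL hB hM
    obtain ⟨C₂, h₂⟩ := SplittingResult.norm_sub_apply_le (m := m) (n := n) q hL hB hM
    refine ⟨C₁ + C₂, ?_⟩
    intro t₀ T ε A' A'' Y₀ Ybar₀ _ hTL hε hO hG h N Y Ybar hh hN hY hYbar
    obtain ⟨E, hE, rfl⟩ := hO.start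
    obtain ⟨Ebar, hEbar, rfl⟩ := hO.startBar
    have e₁ := h₁ t₀ T ε A' A'' E Y h N hTL hε hO.reg' hO.reg'' hG hE hh hN hY
    have e₂ := h₂ t₀ T ε A' A'' Ebar Ybar h N hTL hε hO.reg' hO.reg'' hG hEbar hh hN hYbar
    rw [norm_sub_rev] at e₂
    linarith [norm_sub_le_norm_sub_add_norm_sub Y (A' (t₀ + N * h)) Ybar]
  -- If L, B or M is negative, the hypotheses already fail at t₀, so any constant serves.
  · refine ⟨0, ?_⟩
    intro t₀ T ε A' A'' Y₀ Ybar₀ hT hTL _ hO hG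
    have hmem : t₀ ∈ Icc t₀ T := ⟨le_rfl, hT⟩
    obtain ⟨G, -, hGM⟩ := hG t₀ hmem
    exact absurd ⟨by linarith, (norm_nonneg _).trans (hO.reg'.bound t₀ hmem),
      (norm_nonneg _).trans hGM⟩ hpos

/-! ### Existence of bounded generalized inverses -/

/-- A matrix with a factorization `U * S * Vᵀ` with invertible `S` has the generalized inverse
`V * S⁻¹ * Uᵀ`. -/
theorem LowRankFactors.Represents.exists_generalized_inverse {m n q : ℕ}
    {F : LowRankFactors m n q} {A : Matrix (Fin m) (Fin n) ℝ} (hF : F.Represents A)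
    (hS : IsUnit F.S) {B : ℝ} (hB : ‖F.S⁻¹‖ ≤ B) :
    ∃ G : Matrix (Fin n) (Fin m) ℝ, A * G * A = A ∧ ‖G‖ ≤ q * B := by
  have hU : F.Uᵀ * F.U = 1 := hF.orthU
  have hV : F.Vᵀ * F.V = 1 := hF.orthV
  have hSS : F.S * F.S⁻¹ = 1 := Matrix.mul_nonsing_inv _ ((Matrix.isUnit_iff_isUnit_det _).1 hS)
  refine ⟨F.V * F.S⁻¹ * F.Uᵀ, ?_, ?_⟩
  · rw [hF.eq, toMatrix]
    calc _ = F.U * (F.S * ((F.Vᵀ * F.V) * F.S⁻¹)) * ((F.Uᵀ * F.U) * F.S * F.Vᵀ) := by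
          simp only [Matrix.mul_assoc]
      _ = _ := by simp only [hU, hV, hSS, Matrix.one_mul, Matrix.mul_one, Matrix.mul_assoc]
  · have := frobenius_norm_mul_le_of_le (frobenius_norm_mul_le_of_le (le_refl ‖F.V‖) hB)
      (Matrix.frobenius_norm_transpose F.U).le
    refine this.trans (le_of_eq_of_le (b := ‖F.V‖ * ‖F.U‖ * B) (by ring) ?_)
    have hB0 := (norm_nonneg _).trans hB
    gcongr
    -- ‖V‖‖U‖ ≤ (‖V‖² + ‖U‖²)/2 = q.
    nlinarith [hF.orthU.norm_sq, hF.orthV.norm_sq, sq_nonneg (‖F.V‖ - ‖F.U‖)]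

/-- A matrix of rank `q` can be compressed to the identity matrix of size `q`. -/
theorem Matrix.exists_mul_mul_eq_one_of_rank_eq {m n q : ℕ} {A : Matrix (Fin m) (Fin n) ℝ}
    (hA : A.rank = q) : ∃ (X : Matrix (Fin q) (Fin m) ℝ) (Z : Matrix (Fin n) (Fin q) ℝ),
      X * A * Z = 1 := by
  have hfr : Module.finrank ℝ (Fin q → ℝ) = Module.finrank ℝ (LinearMap.range A.mulVecLin) := by
    rw [Module.finrank_fin_fun]; exact hA.symm
  let e := LinearEquiv.ofFinrankEq _ _ hfr
  -- Z picks preimages of a basis of the range of A, so AZ is injective; X is a left inverse of AZ.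
  obtain ⟨g, hg⟩ := LinearMap.exists_rightInverse_of_surjective A.mulVecLin.rangeRestrict
    A.mulVecLin.range_rangeRestrict
  have hZ : A.mulVecLin ∘ₗ (g ∘ₗ e.toLinearMap) =
      (LinearMap.range A.mulVecLin).subtype ∘ₗ e.toLinearMap := by
    refine LinearMap.ext fun v => ?_
    exact congrArg Subtype.val (LinearMap.congr_fun hg (e v))
  obtain ⟨x, hx⟩ := LinearMap.exists_leftInverse_of_injective (A.mulVecLin ∘ₗ (g ∘ₗ e.toLinearMap))
    (by
      rw [hZ, LinearMap.ker_eq_bot]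
      exact (Submodule.injective_subtype _).comp e.injective)
  refine ⟨LinearMap.toMatrix' x, LinearMap.toMatrix' (g ∘ₗ e.toLinearMap), ?_⟩
  have := congrArg LinearMap.toMatrix' hx
  have hA' : LinearMap.toMatrix' A.mulVecLin = A := LinearMap.toMatrix'_toLin' A
  rwa [LinearMap.toMatrix'_comp, LinearMap.toMatrix'_comp, hA', LinearMap.toMatrix'_id,
    ← Matrix.mul_assoc] at this

/-- A generalized inverse of a matrix of rank `q` from an invertible compression of size `q`. -/
theorem Matrix.mul_compression_inv_mul {m n q : ℕ} {A : Matrix (Fin m) (Fin n) ℝ}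
    (hA : A.rank = q) {X : Matrix (Fin q) (Fin m) ℝ} {Z : Matrix (Fin n) (Fin q) ℝ}
    (hXZ : IsUnit (X * A * Z)) : A * (Z * (X * A * Z)⁻¹ * X) * A = A := by
  have hdet := (Matrix.isUnit_iff_isUnit_det _).1 hXZ
  have hle : LinearMap.range (A * Z).mulVecLin ≤ LinearMap.range A.mulVecLin := by
    rw [Matrix.mulVecLin_mul]
    exact LinearMap.range_comp_le_range _ _
  have hrk : q ≤ (A * Z).rank := by
    calc q = (X * A * Z).rank := by rw [Matrix.rank_of_isUnit _ hXZ, Fintype.card_fin]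
      _ ≤ _ := by rw [Matrix.mul_assoc]; exact Matrix.rank_mul_le_right _ _
  -- As XAZ is invertible, AZ has the full rank q of A and hence the same range. So A = AZW for some
  -- W, and (XAZ)⁻¹XA = W.
  have hrange := Submodule.eq_of_le_of_finrank_le hle (hA.le.trans hrk)
  have hW : ∃ W : Matrix (Fin q) (Fin n) ℝ, A = A * Z * W := by
    have : ∀ j, ∃ w, (A * Z).mulVec w = A.col j := fun j => by
      have : A.col j ∈ LinearMap.range (A * Z).mulVecLin := by
        rw [hrange]
        exact ⟨Pi.single j 1, by simp⟩
      exact this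
    choose w hw using this
    refine ⟨Matrix.of fun i j => w j i, ?_⟩
    ext i j
    exact (congrFun (hw j) i).symm
  obtain ⟨W, hW⟩ := hW
  have hXA : X * A = X * A * Z * W := by
    conv_lhs => rw [hW]
    simp only [Matrix.mul_assoc]
  calc A * (Z * (X * A * Z)⁻¹ * X) * A = A * Z * ((X * A * Z)⁻¹ * (X * A)) := by
        simp only [Matrix.mul_assoc]
    _ = A * Z * ((X * A * Z)⁻¹ * (X * A * Z * W)) := by rw [← hXA]
    _ = A := by rw [← Matrix.mul_assoc (X * A * Z)⁻¹, Matrix.nonsing_inv_mul _ hdet,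
        Matrix.one_mul, ← hW]

/-- A continuous path of matrices of constant rank over a compact set has uniformly bounded
generalized inverses. -/
theorem IsCompact.exists_bounded_generalized_inverse {m n q : ℕ}
    {A : ℝ → Matrix (Fin m) (Fin n) ℝ} {s : Set ℝ} (hs : IsCompact s) (hA : ContinuousOn A s)
    (hrk : ∀ t ∈ s, (A t).rank = q) :
    ∃ M : ℝ, ∀ t ∈ s, ∃ G : Matrix (Fin n) (Fin m) ℝ, A t * G * A t = A t ∧ ‖G‖ ≤ M := by
  -- The property passes to subsets and finite unions, so by compactness it only has to hold near
  -- each point.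
  refine hs.induction_on (p := fun s => ∃ M : ℝ, ∀ t ∈ s, ∃ G : Matrix (Fin n) (Fin m) ℝ,
    A t * G * A t = A t ∧ ‖G‖ ≤ M) ⟨0, by simp⟩ ?_ ?_ ?_
  · rintro u v huv ⟨M, hM⟩
    exact ⟨M, fun t ht => hM t (huv ht)⟩
  · rintro u v ⟨M, hM⟩ ⟨M', hM'⟩
    refine ⟨max M M', ?_⟩
    rintro t (ht | ht)
    · obtain ⟨G, h₁, h₂⟩ := hM t ht
      exact ⟨G, h₁, h₂.trans (le_max_left _ _)⟩
    · obtain ⟨G, h₁, h₂⟩ := hM' t ht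
      exact ⟨G, h₁, h₂.trans (le_max_right _ _)⟩
  · intro t ht
    -- X and Z are fixed at t. For u near t, XA(u)Z remains invertible, and Z(XA(u)Z)⁻¹X is a
    -- generalized inverse of A(u) because A(u) still has rank q; its norm is locally bounded by
    -- continuity.
    obtain ⟨X, Z, hXZ⟩ := Matrix.exists_mul_mul_eq_one_of_rank_eq (hrk t ht)
    have hc : ContinuousWithinAt (fun t => X * A t * Z) s t := by
      have h1 : Continuous fun Y : Matrix (Fin m) (Fin n) ℝ => X * Y * Z := by fun_prop
      exact h1.continuousAt.comp_continuousWithinAt (hA t ht)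
    have hdet : ∀ᶠ u in nhdsWithin t s, IsUnit (X * A u * Z).det := by
      have h1 : ContinuousWithinAt (fun t => (X * A t * Z).det) s t := by
        have h2 : Continuous fun Y : Matrix (Fin q) (Fin q) ℝ => Y.det := continuous_id.matrix_det
        exact h2.continuousAt.comp_continuousWithinAt hc
      have h3 : (X * A t * Z).det ≠ 0 := by simp [hXZ]
      filter_upwards [h1.eventually_ne h3] with u hu using isUnit_iff_ne_zero.2 hu
    have hG : ContinuousWithinAt (fun t => Z * (X * A t * Z)⁻¹ * X) s t := by
      have h1 : Continuous fun Y : Matrix (Fin q) (Fin q) ℝ => Z * Y * X := by fun_prop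
      have h2 : ContinuousAt (fun Y : Matrix (Fin q) (Fin q) ℝ => Y⁻¹) (X * A t * Z) := by
        apply continuousAt_matrix_inv
        rw [hXZ, Matrix.det_one]
        simp
      have h3 : ContinuousWithinAt (fun t => (X * A t * Z)⁻¹) s t :=
        ContinuousAt.comp_continuousWithinAt (f := fun t => X * A t * Z) h2 hc
      exact h1.continuousAt.comp_continuousWithinAt h3
    have hbd : ∀ᶠ u in nhdsWithin t s,
        ‖Z * (X * A u * Z)⁻¹ * X‖ < ‖Z * (X * A t * Z)⁻¹ * X‖ + 1 :=
      hG.norm.eventually_lt_const (lt_add_one _)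
    refine ⟨_, Filter.inter_mem (Filter.inter_mem hdet hbd) self_mem_nhdsWithin,
      ‖Z * (X * A t * Z)⁻¹ * X‖ + 1, ?_⟩
    rintro u ⟨⟨hu₁, hu₂⟩, hu⟩
    exact ⟨_, Matrix.mul_compression_inv_mul (hrk u hu)
      ((Matrix.isUnit_iff_isUnit_det _).2 hu₁), le_of_lt hu₂⟩

/-! ### The two forms of the error bound -/

/-- First part: the constant depends only on the sizes and ranks, on a bound `L` for the length of
the time interval and on a bound `B` for the data, including the inverse of the `q × q` factor
of `A' t`; all data may vary with `ε`.
Second part: when `A'` does not vary with `ε`, no bound on an inverse has to be assumed. -/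
theorem theorem2 (m n q r : ℕ) (hqr : q < r) :
    (∀ L B : ℝ, ∃ C : ℝ, ∀ (t₀ T ε : ℝ) (A' A'' : ℝ → Matrix (Fin m) (Fin n) ℝ)
      (Y₀ Ybar₀ : Matrix (Fin m) (Fin n) ℝ),
      t₀ ≤ T → T - t₀ ≤ L → 0 < ε →
      OverApproximation q r t₀ T B ε A' A'' Y₀ Ybar₀ →
      (∀ t ∈ Icc t₀ T, ∃ F : LowRankFactors m n q,
        F.Represents (A' t) ∧ IsUnit F.S ∧ ‖F.S⁻¹‖ ≤ B) →
      ∀ (h : ℝ) (N : ℕ) (Y Ybar : Matrix (Fin m) (Fin n) ℝ),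
        0 < h → t₀ + N * h ≤ T →
        SplittingResult r (fun t => A' t + ε • A'' t) t₀ h N Y₀ Y →
        SplittingResult q (fun t => A' t + ε • A'' t) t₀ h N Ybar₀ Ybar →
        ‖Y - Ybar‖ ≤ C * (ε + h)) ∧
    (∀ (t₀ T B : ℝ) (A' : ℝ → Matrix (Fin m) (Fin n) ℝ), t₀ ≤ T → ∃ C : ℝ,
      ∀ (ε : ℝ) (A'' : ℝ → Matrix (Fin m) (Fin n) ℝ) (Y₀ Ybar₀ : Matrix (Fin m) (Fin n) ℝ),
      0 < ε →
      OverApproximation q r t₀ T B ε A' A'' Y₀ Ybar₀ →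
      ∀ (h : ℝ) (N : ℕ) (Y Ybar : Matrix (Fin m) (Fin n) ℝ),
        0 < h → t₀ + N * h ≤ T →
        SplittingResult r (fun t => A' t + ε • A'' t) t₀ h N Y₀ Y →
        SplittingResult q (fun t => A' t + ε • A'' t) t₀ h N Ybar₀ Ybar →
        ‖Y - Ybar‖ ≤ C * (ε + h)) := by
  refine ⟨fun L B => ?_, fun t₀ T B A' hT => ?_⟩
  · obtain ⟨C, hC⟩ := SplittingResult.norm_sub_le_of_overApproximation (m := m) (n := n)
      (q := q) (r := r) (L := L) (B := B) (M := q * B)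
    refine ⟨C, fun t₀ T ε A' A'' Y₀ Ybar₀ hT hTL hε hO hF => ?_⟩
    refine hC t₀ T ε A' A'' Y₀ Ybar₀ hT hTL hε hO fun t ht => ?_
    obtain ⟨F, hF, hS, hB⟩ := hF t ht
    exact hF.exists_generalized_inverse hS hB
  -- C must be fixed before ε and the remaining data are given, so what is needed of `A'` is decided
  -- beforehand; if it fails, no admissible data exist and 0 serves.
  · by_cases hA : ContinuousOn A' (Icc t₀ T) ∧ ∀ t ∈ Icc t₀ T, (A' t).rank = q
    · obtain ⟨M, hM⟩ := isCompact_Icc.exists_bounded_generalized_inverse hA.1 hA.2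
      obtain ⟨C, hC⟩ := SplittingResult.norm_sub_le_of_overApproximation (m := m) (n := n)
        (q := q) (r := r) (L := T - t₀) (B := B) (M := M)
      exact ⟨C, fun ε A'' Y₀ Ybar₀ hε hO => hC t₀ T ε A' A'' Y₀ Ybar₀ hT le_rfl hε hO hM⟩
    · exact ⟨0, fun ε A'' Y₀ Ybar₀ _ hO => absurd ⟨hO.reg'.diff.continuousOn, hO.rank_A'⟩ hA⟩
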